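/- Let $G$ be a locally compact, Hausdorff, second countable topological group, and fix a left Haar measure on $G$. Let $\lambda_s$ ($s\in G$), $(\lambda_s\xi)(g)=\xi(s^{-1}g)$, be the left regular representation on $L^2(G)$, and for $f\in L^1(G)$ let $\lambda(f)\xi=\int_G f(s)\,\lambda_s\xi\,ds$. Let $C^*_r(G)$ be the operator norm closure of $\{\lambda(f):f\in L^1(G)\}$ in the bounded operators on $L^2(G)$, let $VN(G)$ be the $w^*$-closure (ultraweak closure) of $C^*_r(G)$, and let $B_1(VN(G))$ be its closed unit ball with the $w^*$-topology. Let $A(G)$ be the set of functions $u(s)=(\lambda_s\xi,\eta)$ with $\xi,\eta\in L^2(G)$; for $T\in VN(G)$ and such $u$ put $\langle u,T\rangle=(T\xi,\eta)$. The support $\mathrm{supp}^*(T)$ is the set of $g\in G$ such that for every open neighbourhood $V$ of $g$ there is $u\in A(G)$ with $\mathrm{supp}(u)\subseteq V$ and $\langle u,T\rangle\neq 0$. Let $\mathcal F(G)$ be the set of closed subsets of $G$ with the Fell topology, which is generated by the sets $\{F:F\cap K=\emptyset\}$ ($K\subseteq G$ compact) and $\{F:F\cap U\ne\emptyset\}$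 ($U\subseteq G$ open). A closed set $E\subseteq G$ is a set of uniqueness if $S\in C^*_r(G)$ and $\mathrm{supp}^*(S)\subseteq E$ imply $S=0$. Let $\mathcal U(G)\subseteq\mathcal F(G)$ be the family of closed sets of uniqueness and $\mathcal M(G)=\mathcal F(G)\setminus\mathcal U(G)$. A set is analytic if it is empty or a continuous image of a Polish space, and coanalytic if its complement is analytic. Then the Fell topology on $\mathcal F(G)$ is Polish, and its Borel $\sigma$-algebra is the Effros $\sigma$-algebra, generated by the sets $\{F:F\cap U\neq\emptyset\}$ with $U\subseteq G$ open; and $\mathcal U(G)$ is a coanalytic subset of $\mathcal F(G)$. Moreover, the set $$\{(S,E)\in B_1(VN(G))\times\mathcal F(G): S\in C^*_r(G),\ S\neq 0,\ \mathrm{supp}^*(S)\subseteq E\}$$ is analytic, and its projection to $\mathcal F(G)$ is $\mathcal M(G)$. -/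

import Mathlib

open MeasureTheory Set Topology

noncomputable section

namespace SetsOfUniqueness

/-! ### The hyperspace of closed sets -/

/-- The hyperspace `𝓕(X)` of closed subsets of `X` (the empty set included). -/
def ClosedSets (X : Type*) [TopologicalSpace X] : Type _ := {F : Set X // IsClosed F}

/-- The Fell topology on `𝓕(X)`: generated by the sets `{F | F ∩ K = ∅}`, `K` compact, and
`{F | F ∩ U ≠ ∅}`, `U` open. -/
instance fellTopology (X : Type*) [TopologicalSpace X] : TopologicalSpace (ClosedSets X) :=
  TopologicalSpace.generateFrom
    ({A | ∃ K : Set X, IsCompact K ∧ A = {F : ClosedSets X | F.1 ∩ K = ∅}} ∪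
      {A | ∃ U : Set X, IsOpen U ∧ A = {F : ClosedSets X | (F.1 ∩ U).Nonempty}})

/-- The Effros `σ`-algebra on `𝓕(X)`: generated by the sets `{F | F ∩ U ≠ ∅}`, `U` open. -/
instance effrosMeasurableSpace (X : Type*) [TopologicalSpace X] :
    MeasurableSpace (ClosedSets X) :=
  MeasurableSpace.generateFrom
    {A | ∃ U : Set X, IsOpen U ∧ A = {F : ClosedSets X | (F.1 ∩ U).Nonempty}}

/-- A set is coanalytic if its complement is analytic. -/
def IsCoanalytic {X : Type*} [TopologicalSpace X] (A : Set X) : Prop := AnalyticSet Aᶜ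

/-! ### The weak-* topology of the bounded operators on a Hilbert space -/

/-- The `w*`-topology on the bounded operators of a Hilbert space `H`, as the dual of the trace
class (the ultraweak topology): the coarsest topology for which all functionals
`T ↦ ∑ₙ (T ξₙ, ηₙ)` with `∑ₙ ‖ξₙ‖² < ∞` and `∑ₙ ‖ηₙ‖² < ∞` are continuous. The Mathlib inner
product is conjugate linear in its first argument, so `(T ξ, η)` is `inner ℂ η (T ξ)`. -/
@[reducible]
def weakStarTopology (H : Type*) [NormedAddCommGroup H] [InnerProductSpace ℂ H] :
    TopologicalSpace (H →L[ℂ] H) :=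
  ⨅ p : {p : (ℕ → H) × (ℕ → H) //
      Summable (fun n => ‖p.1 n‖ ^ 2) ∧ Summable (fun n => ‖p.2 n‖ ^ 2)},
    TopologicalSpace.induced
      (fun T : H →L[ℂ] H => ∑' n, inner ℂ (p.1.2 n) (T (p.1.1 n))) inferInstance

/-! ### The regular representation -/

section Regular

variable {G : Type*} [Group G] [TopologicalSpace G] [IsTopologicalGroup G]
  [MeasurableSpace G] [BorelSpace G] (μ : Measure G) [μ.IsHaarMeasure]

/-- The Hilbert space `L²(G)`. -/
abbrev L2 {G : Type*} [MeasurableSpace G] (μ : Measure G) : Type _ := Lp ℂ 2 μ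

/-- The left regular representation on `L²(G)`: `(λₛ ξ)(g) = ξ(s⁻¹ g)`. -/
def leftRegular (s : G) : L2 μ →L[ℂ] L2 μ :=
  (Lp.compMeasurePreservingₗᵢ ℂ (fun g : G => s⁻¹ * g)
    (measurePreserving_mul_left μ s⁻¹)).toContinuousLinearMap

lemma norm_leftRegular_apply (s : G) (ξ : L2 μ) : ‖leftRegular μ s ξ‖ = ‖ξ‖ :=
  (Lp.compMeasurePreservingₗᵢ ℂ (fun g : G => s⁻¹ * g)
    (measurePreserving_mul_left μ s⁻¹)).norm_map ξ

variable [LocallyCompactSpace G] [SecondCountableTopology G]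

lemma continuous_leftRegular_apply (ξ : L2 μ) : Continuous fun s : G => leftRegular μ s ξ := by
  let g : C(G, C(G, G)) :=
    (ContinuousMap.mk (fun a : G × G => a.1⁻¹ * a.2) (by fun_prop)).curry
  exact (continuous_const (y := ξ)).compMeasurePreservingLp g.continuous
    (fun s => measurePreserving_mul_left μ s⁻¹) (by norm_num)

lemma integrable_smul_leftRegular (f : Lp ℂ 1 μ) (ξ : L2 μ) :
    Integrable (fun s => f s • leftRegular μ s ξ) μ := by
  refine (L1.integrable_coeFn f).smul_bdd (C := ‖ξ‖) ?_ ?_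
  · exact (continuous_leftRegular_apply μ ξ).aestronglyMeasurable
  · exact Filter.Eventually.of_forall fun s => (norm_leftRegular_apply μ s ξ).le

/-- The representation of `L¹(G)` on `L²(G)`: `λ(f) ξ = ∫ f(s) λₛ ξ ds`. -/
def lambdaL1 (f : Lp ℂ 1 μ) : L2 μ →L[ℂ] L2 μ :=
  LinearMap.mkContinuous
    { toFun := fun ξ => ∫ s, f s • leftRegular μ s ξ ∂μ
      map_add' := fun ξ η => by
        simp only [map_add, smul_add]
        exact integral_add (integrable_smul_leftRegular μ f ξ) (integrable_smul_leftRegular μ f η)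
      map_smul' := fun c ξ => by
        simp only [map_smul, RingHom.id_apply]
        rw [← integral_smul]
        exact integral_congr_ae (Filter.Eventually.of_forall fun s => smul_comm _ _ _) }
    ‖f‖ (fun ξ => by
      refine (norm_integral_le_integral_norm _).trans (le_of_eq ?_)
      simp only [norm_smul, norm_leftRegular_apply]
      rw [integral_mul_const, L1.norm_eq_integral_norm])

/-- The reduced group C*-algebra `C*_r(G)`: the operator norm closure of `{λ(f) : f ∈ L¹(G)}`. -/
def reducedCStar : Set (L2 μ →L[ℂ] L2 μ) := closure (range (lambdaL1 μ))

/-- The group von Neumann algebra `VN(G)`: the `w*`-closure of `C*_r(G)`. -/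
def groupVN : Set (L2 μ →L[ℂ] L2 μ) :=
  @closure _ (weakStarTopology (L2 μ)) (reducedCStar μ)

/-- The function `u(s) = (λₛ ξ, η)` on `G`. The Fourier algebra `A(G)` consists of precisely
these functions, with `ξ, η ∈ L²(G)`. -/
def coeff (ξ η : L2 μ) (s : G) : ℂ := inner ℂ η (leftRegular μ s ξ)

/-- The support `supp*(T)` of an operator `T ∈ VN(G)`: the set of all `g` such that every open
neighbourhood `V` of `g` admits some `u ∈ A(G)` with `supp(u) ⊆ V` and `⟨u, T⟩ ≠ 0`. Here `u` is
written as `u(s) = (λₛ ξ, η)`, and then `⟨u, T⟩ = (T ξ, η)`. -/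
def opSupport (T : L2 μ →L[ℂ] L2 μ) : Set G :=
  {g | ∀ V : Set G, IsOpen V → g ∈ V →
    ∃ ξ η : L2 μ, tsupport (coeff μ ξ η) ⊆ V ∧ inner ℂ η (T ξ) ≠ 0}

/-! ### Sets of uniqueness -/

/-- The family `𝓤(G)` of closed sets of uniqueness. -/
def uniquenessSets : Set (ClosedSets G) :=
  {E | ∀ S ∈ reducedCStar μ, opSupport μ S ⊆ E.1 → S = 0}

/-- The family `𝓜(G)` of closed sets of multiplicity: the closed sets that are not sets of
uniqueness. -/
def multiplicitySets : Set (ClosedSets G) := (uniquenessSets μ)ᶜ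

/-- The closed unit ball `B₁(VN(G))` of the group von Neumann algebra. -/
def UnitBallVN : Type _ := {T : L2 μ →L[ℂ] L2 μ // T ∈ groupVN μ ∧ ‖T‖ ≤ 1}

/-- The `w*`-topology on `B₁(VN(G))`. -/
instance unitBallVNTopology : TopologicalSpace (UnitBallVN μ) :=
  (weakStarTopology (L2 μ)).induced Subtype.val

/-- The set of all pairs `(S, E)` in `B₁(VN(G)) × 𝓕(G)` such that `S` is a nonzero element of
`C*_r(G)` and `supp*(S) ⊆ E`. -/
def multiplicityPairs : Set (UnitBallVN μ × ClosedSets G) :=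
  {p | p.1.1 ∈ reducedCStar μ ∧ p.1.1 ≠ 0 ∧ opSupport μ p.1.1 ⊆ p.2.1}

end Regular

end SetsOfUniqueness

end

/-!
The multiplicity pairs form a Borel subset of a Polish space, hence an analytic set. Projecting to
`𝓕(G)` gives `𝓜(G)`, since a nonzero `S ∈ C*_r(G)` can be scaled into the unit ball without changing
its support (`image_snd_multiplicityPairs`). So `𝓜(G)` is analytic and `𝓤(G)` coanalytic.

Both factors are compact, Hausdorff and second countable, hence Polish. For `𝓕(G)`, compactness is
Alexander's subbasis theorem (`compactSpace_closedSets`), and a countable subbasis comes from the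
relatively compact members of a countable basis of `G`; covering a compact `K` by finitely many of
them also shows that `{F | F ∩ K = ∅}` lies in the Effros `σ`-algebra (`measurableSet_miss`). On the
unit ball of the bounded operators the `w*`-topology is the weak operator topology
(`isInducing_matrixCoeff`). It is compact, because the bounded sesquilinear forms are closed in a
product of discs, and countably many matrix coefficients separate operators on a separable space
(`polishSpace_operatorBall`). `B₁(VN(G))` is closed in that ball.

For Borel measurability, `S ∈ C*_r(G)` says that `S` is a norm limit of a sequence from a fixed
countable family, and closed norm balls are `w*`-closed (`measurableSet_mem_reducedCStar`). For a
fixed open `V`, the condition that `S` annihilates every `u ∈ A(G)` supported in `V` is `w*`-closed,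
and compactness reduces `supp*(S) ⊆ E` to countably many such conditions and conditions
`E ∩ K = ∅` (`opSupport_subset_iff`, `measurableSet_opSupport_subset`). No partition of unity in
`A(G)` is needed.
-/

namespace SetsOfUniqueness

/-! ### The Fell topology -/

section Fell

variable {X : Type*} [TopologicalSpace X]

lemma exists_finite_subcover_sUnion {K : Set X} (hK : IsCompact K) {𝒰 : Set (Set X)}
    (h𝒰 : ∀ U ∈ 𝒰, IsOpen U) (h : K ⊆ ⋃₀ 𝒰) : ∃ t ⊆ 𝒰, t.Finite ∧ K ⊆ ⋃₀ t := by
  simp only [sUnion_eq_biUnion] at h ⊢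
  exact hK.elim_finite_subcover_image (c := id) h𝒰 h

lemma ClosedSets.ext {E F : ClosedSets X} (h : E.1 = F.1) : E = F := Subtype.ext h

lemma isOpen_miss {K : Set X} (hK : IsCompact K) :
    IsOpen {F : ClosedSets X | F.1 ∩ K = ∅} :=
  TopologicalSpace.isOpen_generateFrom_of_mem (Or.inl ⟨K, hK, rfl⟩)

lemma isOpen_hit {U : Set X} (hU : IsOpen U) :
    IsOpen {F : ClosedSets X | (F.1 ∩ U).Nonempty} :=
  TopologicalSpace.isOpen_generateFrom_of_mem (Or.inr ⟨U, hU, rfl⟩)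

lemma measurableSet_hit {U : Set X} (hU : IsOpen U) :
    MeasurableSet {F : ClosedSets X | (F.1 ∩ U).Nonempty} :=
  MeasurableSpace.measurableSet_generateFrom ⟨U, hU, rfl⟩

/-- By Alexander's subbasis theorem: if the complements of the compact sets `Kᵢ` and the open sets
`Uⱼ` give a subbasic cover of `𝓕(X)`, then the closed set `(⋃ⱼ Uⱼ)ᶜ` misses some `Kᵢ`, so that
`Kᵢ` is covered by finitely many `Uⱼ`. -/
instance compactSpace_closedSets : CompactSpace (ClosedSets X) := by
  refine compactSpace_generateFrom rfl fun P hP hcov => ?_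
  set 𝒰 : Set (Set X) := {U | IsOpen U ∧ {F : ClosedSets X | (F.1 ∩ U).Nonempty} ∈ P} with h𝒰
  have hopen : IsOpen (⋃₀ 𝒰) := isOpen_sUnion fun U hU => hU.1
  obtain ⟨A, hA, hFA⟩ : (⟨(⋃₀ 𝒰)ᶜ, hopen.isClosed_compl⟩ : ClosedSets X) ∈ ⋃₀ P :=
    hcov ▸ mem_univ _
  rcases hP hA with ⟨K, hK, rfl⟩ | ⟨U, hU, rfl⟩
  · have hKU : K ⊆ ⋃₀ 𝒰 := by
      intro x hx
      by_contra hx'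
      exact (hFA : (⋃₀ 𝒰)ᶜ ∩ K = ∅).subset ⟨hx', hx⟩
    obtain ⟨t, ht, htf, hKt⟩ := exists_finite_subcover_sUnion hK (fun U hU => hU.1) hKU
    refine ⟨insert {F : ClosedSets X | F.1 ∩ K = ∅}
      ((fun U => {F : ClosedSets X | (F.1 ∩ U).Nonempty}) '' t), ?_, (htf.image _).insert _, ?_⟩
    · rintro _ (rfl | ⟨U, hU, rfl⟩)
      · exact hA
      · exact (ht hU).2
    · refine eq_univ_of_forall fun F => ?_
      rcases (F.1 ∩ K).eq_empty_or_nonempty with h | ⟨x, hxF, hxK⟩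
      · exact ⟨_, Or.inl rfl, h⟩
      · obtain ⟨U, hU, hxU⟩ := hKt hxK
        exact ⟨_, Or.inr ⟨U, hU, rfl⟩, x, hxF, hxU⟩
  · obtain ⟨x, hx, hxU⟩ := hFA
    exact (hx ⟨U, ⟨hU, hA⟩, hxU⟩).elim

instance t2Space_closedSets [LocallyCompactSpace X] : T2Space (ClosedSets X) := by
  have key : ∀ E F : ClosedSets X, ¬ E.1 ⊆ F.1 → ∃ u v : Set (ClosedSets X),
      IsOpen u ∧ IsOpen v ∧ E ∈ u ∧ F ∈ v ∧ Disjoint u v := by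
    intro E F h
    obtain ⟨x, hxE, hxF⟩ := not_subset.1 h
    obtain ⟨K, hK, hxK, hKF⟩ := exists_compact_subset F.2.isOpen_compl hxF
    refine ⟨_, _, isOpen_hit isOpen_interior, isOpen_miss hK, ⟨x, hxE, hxK⟩, ?_, ?_⟩
    · exact eq_empty_of_forall_notMem fun y hy => hKF hy.2 hy.1
    · refine disjoint_left.2 ?_
      rintro A ⟨y, hyA, hyK⟩ hA
      exact (hA : A.1 ∩ K = ∅).subset ⟨hyA, interior_subset hyK⟩
  refine ⟨fun E F hEF => ?_⟩
  by_cases h : E.1 ⊆ F.1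
  · have h' : ¬ F.1 ⊆ E.1 := fun h' => hEF (ClosedSets.ext (h.antisymm h'))
    obtain ⟨u, v, hu, hv, hF, hE, huv⟩ := key F E h'
    exact ⟨v, u, hv, hu, hE, hF, huv.symm⟩
  · exact key E F h

variable (X) in
/-- The members with compact closure of a fixed countable basis of `X`. In a locally compact
Hausdorff space they again form a basis. -/
def precompactBasis [SecondCountableTopology X] : Set (Set X) :=
  {u | u ∈ TopologicalSpace.countableBasis X ∧ IsCompact (closure u)}

variable [SecondCountableTopology X]

lemma countable_precompactBasis : (precompactBasis X).Countable :=
  (TopologicalSpace.countable_countableBasis X).mono fun _ h => h.1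

lemma isOpen_of_mem_precompactBasis {u : Set X} (hu : u ∈ precompactBasis X) : IsOpen u :=
  TopologicalSpace.isOpen_of_mem_countableBasis hu.1

variable [LocallyCompactSpace X] [T2Space X]

lemma exists_mem_precompactBasis {O : Set X} (hO : IsOpen O) {x : X} (hx : x ∈ O) :
    ∃ u ∈ precompactBasis X, x ∈ u ∧ closure u ⊆ O := by
  obtain ⟨K, hK, hxK, hKO⟩ := exists_compact_subset hO hx
  obtain ⟨u, hu, hxu, huK⟩ := (TopologicalSpace.isBasis_countableBasis X).exists_subset_of_mem_open
    hxK isOpen_interior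
  have hcl : closure u ⊆ K := closure_minimal (huK.trans interior_subset) hK.isClosed
  exact ⟨u, ⟨hu, hK.of_isClosed_subset isClosed_closure hcl⟩, hxu, hcl.trans hKO⟩

/-- A compact set missed by a closed set `F` has a finite cover by basic open sets whose closures
are missed by `F`. -/
lemma exists_finite_precompact_cover {F K : Set X} (hF : IsClosed F) (hK : IsCompact K)
    (h : F ∩ K = ∅) : ∃ t ⊆ precompactBasis X, t.Finite ∧ K ⊆ ⋃₀ t ∧
      ∀ u ∈ t, F ∩ closure u = ∅ := by
  obtain ⟨t, ht, htf, hKt⟩ := exists_finite_subcover_sUnion hK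
    (𝒰 := {u | u ∈ precompactBasis X ∧ closure u ⊆ Fᶜ})
    (fun u hu => isOpen_of_mem_precompactBasis hu.1) (fun x hx => by
      have hxF : x ∈ Fᶜ := fun hxF => h.subset ⟨hxF, hx⟩
      obtain ⟨u, hu, hxu, huF⟩ := exists_mem_precompactBasis hF.isOpen_compl hxF
      exact ⟨u, ⟨hu, huF⟩, hxu⟩)
  exact ⟨t, fun u hu => (ht hu).1, htf, hKt, fun u hu =>
    eq_empty_of_forall_notMem fun x hx => (ht hu).2 hx.2 hx.1⟩

instance secondCountableTopology_closedSets : SecondCountableTopology (ClosedSets X) := by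
  set 𝒮 : Set (Set (ClosedSets X)) :=
    (fun u => {F : ClosedSets X | F.1 ∩ closure u = ∅}) '' precompactBasis X ∪
      (fun u => {F : ClosedSets X | (F.1 ∩ u).Nonempty}) '' precompactBasis X with h𝒮
  refine ⟨𝒮, (countable_precompactBasis.image _).union (countable_precompactBasis.image _),
    le_antisymm ?_ ?_⟩
  · refine le_generateFrom ?_
    rintro _ (⟨u, hu, rfl⟩ | ⟨u, hu, rfl⟩)
    · exact isOpen_miss hu.2
    · exact isOpen_hit (isOpen_of_mem_precompactBasis hu)
  · refine le_generateFrom ?_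
    rintro _ (⟨K, hK, rfl⟩ | ⟨U, hU, rfl⟩)
    · let := TopologicalSpace.generateFrom 𝒮
      refine isOpen_iff_forall_mem_open.2 fun F hF => ?_
      obtain ⟨t, ht, htf, hKt, hFt⟩ := exists_finite_precompact_cover F.2 hK hF
      refine ⟨⋂ u ∈ t, {E : ClosedSets X | E.1 ∩ closure u = ∅}, ?_, ?_, ?_⟩
      · intro E hE
        refine eq_empty_of_forall_notMem fun x hx => ?_
        obtain ⟨u, hu, hxu⟩ := hKt hx.2
        exact (mem_iInter₂.1 hE u hu : E.1 ∩ closure u = ∅).subset ⟨hx.1, subset_closure hxu⟩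
      · exact htf.isOpen_biInter fun u hu =>
          TopologicalSpace.isOpen_generateFrom_of_mem (Or.inl ⟨u, ht hu, rfl⟩)
      · exact mem_iInter₂.2 hFt
    · let := TopologicalSpace.generateFrom 𝒮
      refine isOpen_iff_forall_mem_open.2 ?_
      rintro F ⟨x, hxF, hxU⟩
      obtain ⟨u, hu, hxu, huU⟩ := exists_mem_precompactBasis hU hxU
      refine ⟨{E : ClosedSets X | (E.1 ∩ u).Nonempty}, ?_, ?_, ⟨x, hxF, hxu⟩⟩
      · rintro E ⟨y, hyE, hyu⟩
        exact ⟨y, hyE, huU (subset_closure hyu)⟩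
      · exact TopologicalSpace.isOpen_generateFrom_of_mem (Or.inr ⟨u, hu, rfl⟩)

instance polishSpace_closedSets : PolishSpace (ClosedSets X) := by
  let := TopologicalSpace.metrizableSpaceMetric (ClosedSets X)
  infer_instance

/-- The set of all `F` missing `K` is the countable union, over all finite covers of `K` by basic
open sets, of the sets of all `F` that miss each member of the cover. -/
lemma measurableSet_miss {K : Set X} (hK : IsCompact K) :
    MeasurableSet {F : ClosedSets X | F.1 ∩ K = ∅} := by
  have : {F : ClosedSets X | F.1 ∩ K = ∅} =
      ⋃ t ∈ {t : Set (Set X) | (t.Finite ∧ t ⊆ precompactBasis X) ∧ K ⊆ ⋃₀ t},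
        ⋂ u ∈ t, {F : ClosedSets X | (F.1 ∩ u).Nonempty}ᶜ := by
    ext F
    simp only [mem_iUnion₂, mem_iInter₂]
    constructor
    · intro hF
      obtain ⟨t, ht, htf, hKt, hFt⟩ := exists_finite_precompact_cover F.2 hK hF
      refine ⟨t, ⟨⟨htf, ht⟩, hKt⟩, fun u hu hne => ?_⟩
      obtain ⟨x, hxF, hxu⟩ := hne
      exact (hFt u hu).subset ⟨hxF, subset_closure hxu⟩
    · rintro ⟨t, ⟨-, hKt⟩, hFt⟩
      refine eq_empty_of_forall_notMem fun x hx => ?_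
      obtain ⟨u, hu, hxu⟩ := hKt hx.2
      exact hFt u hu ⟨x, hx.1, hxu⟩
  rw [this]
  refine MeasurableSet.biUnion ((countable_ofPred_finite_subset countable_precompactBasis).mono
    fun t ht => ht.1) fun t ht => ?_
  exact MeasurableSet.biInter ht.1.1.countable fun u hu =>
    (measurableSet_hit (isOpen_of_mem_precompactBasis (ht.1.2 hu))).compl

instance borelSpace_closedSets : BorelSpace (ClosedSets X) := by
  refine ⟨le_antisymm (MeasurableSpace.generateFrom_le ?_) ?_⟩
  · rintro _ ⟨U, hU, rfl⟩
    exact MeasurableSpace.measurableSet_generateFrom (isOpen_hit hU)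
  · rw [borel_eq_generateFrom_of_subbasis (t := fellTopology X) rfl]
    refine MeasurableSpace.generateFrom_le ?_
    rintro _ (⟨K, hK, rfl⟩ | ⟨U, hU, rfl⟩)
    · exact measurableSet_miss hK
    · exact measurableSet_hit hU

end Fell

/-! ### The unit ball of the bounded operators in the weak-* topology -/

section Ball

variable {H : Type*} [NormedAddCommGroup H] [InnerProductSpace ℂ H]

variable (H) in
/-- The closed unit ball of the bounded operators on `H`, to be given the `w*`-topology. -/
def OperatorBall : Type _ := {T : H →L[ℂ] H // ‖T‖ ≤ 1}

noncomputable instance : TopologicalSpace (OperatorBall H) := (weakStarTopology H).induced Subtype.val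

lemma continuous_inner_weakStar (ξ η : H) :
    Continuous[weakStarTopology H, inferInstance] fun T : H →L[ℂ] H => inner ℂ η (T ξ) := by
  have hs : ∀ ζ : H, Summable fun n : ℕ => ‖(Pi.single 0 ζ : ℕ → H) n‖ ^ 2 := fun ζ =>
    summable_of_ne_finset_zero (s := {0}) fun n hn => by
      rw [Pi.single_eq_of_ne (by simpa using hn)]; simp
  refine continuous_iff_le_induced.2 ((iInf_le _ ⟨(Pi.single 0 ξ, Pi.single 0 η),
    hs ξ, hs η⟩).trans (le_of_eq ?_))
  congr 1
  funext T
  rw [tsum_eq_single 0]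
  · simp
  · intro n hn
    simp [Pi.single_eq_of_ne hn]

lemma continuous_inner_operatorBall (ξ η : H) :
    Continuous fun T : OperatorBall H => inner ℂ η (T.1 ξ) :=
  @Continuous.comp _ _ _ _ (weakStarTopology H) _ _ _ (continuous_inner_weakStar ξ η)
    continuous_induced_dom

/-- The family of all matrix coefficients `(T ξ, η)` of an operator `T`, indexed by the pairs
`(ξ, η)`. -/
noncomputable def matrixCoeff (T : OperatorBall H) (p : H × H) : ℂ := inner ℂ p.2 (T.1 p.1)

lemma norm_matrixCoeff_le (T : OperatorBall H) (ξ η : H) :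
    ‖(inner ℂ η (T.1 ξ) : ℂ)‖ ≤ ‖ξ‖ * ‖η‖ := by
  refine (norm_inner_le_norm _ _).trans ?_
  rw [mul_comm]
  gcongr
  exact (T.1.le_opNorm ξ).trans (mul_le_of_le_one_left (norm_nonneg _) T.2)

/-- On bounded sets the `w*`-topology is the weak operator topology: the series defining a
`w*`-continuous functional converges uniformly on the unit ball. -/
lemma isInducing_matrixCoeff : IsInducing (matrixCoeff (H := H)) := by
  have hc : Continuous (matrixCoeff (H := H)) :=
    continuous_pi fun p => continuous_inner_operatorBall p.1 p.2
  refine ⟨le_antisymm (continuous_iff_le_induced.1 hc) ?_⟩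
  refine continuous_iff_le_induced.1 (continuous_iInf_rng.2 fun p => continuous_induced_rng.2 ?_)
  let : TopologicalSpace (OperatorBall H) := TopologicalSpace.induced matrixCoeff inferInstance
  refine continuous_tsum (u := fun n => ‖p.1.1 n‖ ^ 2 + ‖p.1.2 n‖ ^ 2) (fun n => ?_)
    (p.2.1.add p.2.2) (fun n T => ?_)
  · have h : Continuous (matrixCoeff (H := H)) := continuous_induced_dom
    exact continuous_pi_iff.1 h (p.1.1 n, p.1.2 n)
  · refine (norm_matrixCoeff_le T _ _).trans ?_
    nlinarith [sq_nonneg (‖p.1.1 n‖ - ‖p.1.2 n‖), sq_nonneg (‖p.1.1 n‖ + ‖p.1.2 n‖)]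

/-- The sesquilinear forms of norm at most one, linear in the first and conjugate linear in the
second variable, as functions on `H × H`. -/
def boundedForms (H : Type*) [NormedAddCommGroup H] [InnerProductSpace ℂ H] : Set (H × H → ℂ) :=
  {b | (∀ ξ ξ' η, b (ξ + ξ', η) = b (ξ, η) + b (ξ', η)) ∧
    (∀ (c : ℂ) ξ η, b (c • ξ, η) = c * b (ξ, η)) ∧
    (∀ ξ η η', b (ξ, η + η') = b (ξ, η) + b (ξ, η')) ∧
    (∀ (c : ℂ) ξ η, b (ξ, c • η) = starRingEnd ℂ c * b (ξ, η)) ∧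
    ∀ ξ η, ‖b (ξ, η)‖ ≤ ‖ξ‖ * ‖η‖}

lemma isCompact_boundedForms : IsCompact (boundedForms H) := by
  refine (isCompact_univ_pi fun p : H × H =>
    isCompact_closedBall (0 : ℂ) (‖p.1‖ * ‖p.2‖)).of_isClosed_subset ?_ ?_
  · simp only [boundedForms, ofPred_and, ofPred_forall]
    refine IsClosed.inter ?_ (IsClosed.inter ?_ (IsClosed.inter ?_ (IsClosed.inter ?_ ?_)))
    · exact isClosed_iInter fun _ => isClosed_iInter fun _ => isClosed_iInter fun _ =>
        isClosed_eq (by fun_prop) (by fun_prop)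
    · exact isClosed_iInter fun _ => isClosed_iInter fun _ => isClosed_iInter fun _ =>
        isClosed_eq (by fun_prop) (by fun_prop)
    · exact isClosed_iInter fun _ => isClosed_iInter fun _ => isClosed_iInter fun _ =>
        isClosed_eq (by fun_prop) (by fun_prop)
    · exact isClosed_iInter fun _ => isClosed_iInter fun _ => isClosed_iInter fun _ =>
        isClosed_eq (by fun_prop) (by fun_prop)
    · exact isClosed_iInter fun _ => isClosed_iInter fun _ =>
        isClosed_le (by fun_prop) (by fun_prop)
  · rintro b ⟨-, -, -, -, hb⟩ p -
    simpa using hb p.1 p.2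

lemma opNorm_le_iff_inner {T : H →L[ℂ] H} {C : ℝ} (hC : 0 ≤ C) :
    ‖T‖ ≤ C ↔ ∀ ξ η, ‖(inner ℂ η (T ξ) : ℂ)‖ ≤ C * (‖ξ‖ * ‖η‖) := by
  constructor
  · intro h ξ η
    refine (norm_inner_le_norm _ _).trans ?_
    rw [mul_comm, ← mul_assoc]
    gcongr
    exact T.le_of_opNorm_le h ξ
  · intro h
    refine T.opNorm_le_of_re_inner_le hC fun ξ η hξ hη => ?_
    have h1 : RCLike.re (inner ℂ (T ξ) η : ℂ) = RCLike.re (inner ℂ η (T ξ) : ℂ) :=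
      inner_re_symm _ _
    rw [h1]
    simpa [hξ, hη] using (RCLike.re_le_norm _).trans (h ξ η)

/-- Every sesquilinear form of norm at most one is `(T ξ, η)` for an operator `T` in the unit ball,
by the Riesz representation theorem. -/
lemma range_matrixCoeff [CompleteSpace H] : range (matrixCoeff (H := H)) = boundedForms H := by
  ext b
  constructor
  · rintro ⟨T, rfl⟩
    refine ⟨fun ξ ξ' η => ?_, fun c ξ η => ?_, fun ξ η η' => ?_, fun c ξ η => ?_, fun ξ η => ?_⟩
    · simp [matrixCoeff]
    · simp [matrixCoeff]
    · simp [matrixCoeff]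
    · simp [matrixCoeff, mul_comm]
    · exact norm_matrixCoeff_le T ξ η
  · rintro ⟨h1, h2, h3, h4, h5⟩
    let B : H →L⋆[ℂ] H →L[ℂ] ℂ := LinearMap.mkContinuous₂
      (LinearMap.mk₂'ₛₗ (starRingEnd ℂ) (RingHom.id ℂ) (fun η ξ => b (ξ, η))
        (fun η η' ξ => h3 ξ η η') (fun c η ξ => h4 c ξ η) (fun η ξ ξ' => h1 ξ ξ' η)
        (fun c η ξ => h2 c ξ η)) 1 (fun η ξ => by
          rw [one_mul, mul_comm]; exact h5 ξ η)
    let T : H →L[ℂ] H :=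
      ContinuousLinearMap.adjoint (InnerProductSpace.continuousLinearMapOfBilin B)
    have hT : ∀ ξ η, (inner ℂ η (T ξ) : ℂ) = b (ξ, η) := fun ξ η => by
      rw [ContinuousLinearMap.adjoint_inner_right,
        InnerProductSpace.continuousLinearMapOfBilin_apply]
      rfl
    refine ⟨⟨T, (opNorm_le_iff_inner zero_le_one).2 fun ξ η => ?_⟩, funext fun p => hT p.1 p.2⟩
    rw [hT, one_mul]
    exact h5 ξ η

/-- The unit ball is homeomorphic to the set of bounded forms, which is closed in a product of
discs. -/
instance compactSpace_operatorBall [CompleteSpace H] : CompactSpace (OperatorBall H) := by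
  refine ⟨isInducing_matrixCoeff.isCompact_iff.2 ?_⟩
  rw [image_univ, range_matrixCoeff]
  exact isCompact_boundedForms

/-- The matrix coefficients at a dense sequence separate operators, so they embed the compact unit
ball as a closed subspace of `ℂ^(ℕ × ℕ)`. -/
instance polishSpace_operatorBall [CompleteSpace H] [TopologicalSpace.SeparableSpace H] :
    PolishSpace (OperatorBall H) := by
  set d := TopologicalSpace.denseSeq H
  have hd : DenseRange d := TopologicalSpace.denseRange_denseSeq H
  let Φ : OperatorBall H → (ℕ × ℕ → ℂ) := fun T p => inner ℂ (d p.2) (T.1 (d p.1))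
  have hΦ : Continuous Φ := continuous_pi fun p => continuous_inner_operatorBall _ _
  have hinj : Function.Injective Φ := by
    intro S T h
    refine Subtype.ext (ContinuousLinearMap.coeFn_injective
      (hd.equalizer S.1.continuous T.1.continuous (funext fun n => ?_)))
    exact hd.eq_of_inner_right ℂ fun m => congrFun h (n, m)
  exact (hΦ.isClosedEmbedding hinj).polishSpace

end Ball

/-! ### Measurability of the pairs -/

section Pairs

variable {G : Type*} [Group G] [TopologicalSpace G] [IsTopologicalGroup G]
  [MeasurableSpace G] [BorelSpace G] (μ : Measure G) [μ.IsHaarMeasure]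

lemma opSupport_smul {c : ℂ} (hc : c ≠ 0) (T : L2 μ →L[ℂ] L2 μ) :
    opSupport μ (c • T) = opSupport μ T := by
  simp [opSupport, inner_smul_right, hc]

/-- The operator `T` vanishes on `V` if it annihilates all `u ∈ A(G)` supported in `V`. -/
def VanishesOn (T : L2 μ →L[ℂ] L2 μ) (V : Set G) : Prop :=
  ∀ ξ η : L2 μ, tsupport (coeff μ ξ η) ⊆ V → inner ℂ η (T ξ) = 0

variable {μ} in
lemma VanishesOn.mono {T : L2 μ →L[ℂ] L2 μ} {V W : Set G} (h : VanishesOn μ T W) (hVW : V ⊆ W) :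
    VanishesOn μ T V := fun ξ η hV => h ξ η (hV.trans hVW)

lemma notMem_opSupport_iff {T : L2 μ →L[ℂ] L2 μ} {g : G} :
    g ∉ opSupport μ T ↔ ∃ V, IsOpen V ∧ g ∈ V ∧ VanishesOn μ T V := by
  simp only [opSupport, mem_ofPred_eq, VanishesOn]
  push Not
  rfl

variable [LocallyCompactSpace G] [SecondCountableTopology G]

lemma lambdaL1_apply (f : Lp ℂ 1 μ) (ξ : L2 μ) :
    lambdaL1 μ f ξ = ∫ s, f s • leftRegular μ s ξ ∂μ := rfl

lemma norm_lambdaL1_le (f : Lp ℂ 1 μ) : ‖lambdaL1 μ f‖ ≤ ‖f‖ :=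
  LinearMap.mkContinuous_norm_le _ (norm_nonneg f) _

lemma lambdaL1_sub (f g : Lp ℂ 1 μ) : lambdaL1 μ (f - g) = lambdaL1 μ f - lambdaL1 μ g := by
  ext1 ξ
  rw [sub_apply, lambdaL1_apply, lambdaL1_apply, lambdaL1_apply,
    ← integral_sub (integrable_smul_leftRegular μ f ξ) (integrable_smul_leftRegular μ g ξ)]
  refine integral_congr_ae ?_
  filter_upwards [Lp.coeFn_sub f g] with s hs
  rw [hs, Pi.sub_apply, sub_smul]

lemma lambdaL1_smul (c : ℂ) (f : Lp ℂ 1 μ) : lambdaL1 μ (c • f) = c • lambdaL1 μ f := by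
  ext1 ξ
  rw [smul_apply, lambdaL1_apply, lambdaL1_apply, ← integral_smul]
  refine integral_congr_ae ?_
  filter_upwards [Lp.coeFn_smul c f] with s hs
  rw [hs, Pi.smul_apply, smul_assoc]

lemma continuous_lambdaL1 : Continuous (lambdaL1 μ) :=
  (LipschitzWith.of_dist_le_mul (K := 1) fun f g => by
    rw [dist_eq_norm, dist_eq_norm, ← lambdaL1_sub, NNReal.coe_one, one_mul]
    exact norm_lambdaL1_le μ _).continuous

lemma smul_mem_reducedCStar (c : ℂ) {T : L2 μ →L[ℂ] L2 μ} (hT : T ∈ reducedCStar μ) :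
    c • T ∈ reducedCStar μ := by
  refine map_mem_closure (continuous_const_smul c) hT ?_
  rintro _ ⟨f, rfl⟩
  exact ⟨c • f, lambdaL1_smul μ c f⟩

lemma reducedCStar_subset_groupVN : reducedCStar μ ⊆ groupVN μ :=
  @subset_closure _ (weakStarTopology (L2 μ)) _

/-- The inclusion of `B₁(VN(G))` into the unit ball of all bounded operators. -/
def UnitBallVN.toOperatorBall (S : UnitBallVN μ) : OperatorBall (L2 μ) := ⟨S.1, S.2.2⟩

lemma isClosedEmbedding_toOperatorBall :
    IsClosedEmbedding (UnitBallVN.toOperatorBall μ) := by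
  refine ⟨⟨⟨?_⟩, fun S T h => Subtype.ext (congrArg (fun A : OperatorBall (L2 μ) => A.1) h)⟩, ?_⟩
  · exact (induced_compose (tγ := weakStarTopology (L2 μ)) (f := UnitBallVN.toOperatorBall μ)
      (g := fun T : OperatorBall (L2 μ) => T.1)).symm
  · have : range (UnitBallVN.toOperatorBall μ) =
        {T : OperatorBall (L2 μ) | T.1 ∈ groupVN μ} := by
      ext T
      exact ⟨fun ⟨S, hS⟩ => hS ▸ S.2.1, fun hT => ⟨⟨T.1, hT, T.2⟩, rfl⟩⟩
    rw [this]
    exact @IsClosed.preimage _ _ _ (weakStarTopology (L2 μ)) _ continuous_induced_dom _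
      (@isClosed_closure _ (weakStarTopology (L2 μ)) _)

instance polishSpace_unitBallVN : PolishSpace (UnitBallVN μ) :=
  have : Fact ((2 : ENNReal) ≠ ⊤) := ⟨by simp⟩
  (isClosedEmbedding_toOperatorBall μ).polishSpace

lemma continuous_inner_unitBallVN (ξ η : L2 μ) :
    Continuous fun S : UnitBallVN μ => (inner ℂ η (S.1 ξ) : ℂ) :=
  (continuous_inner_operatorBall ξ η).comp (isClosedEmbedding_toOperatorBall μ).continuous

lemma isClosed_norm_sub_le (A : L2 μ →L[ℂ] L2 μ) {C : ℝ} (hC : 0 ≤ C) :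
    IsClosed {S : UnitBallVN μ | ‖S.1 - A‖ ≤ C} := by
  simp only [opNorm_le_iff_inner hC, sub_apply, inner_sub_right, ofPred_forall]
  exact isClosed_iInter fun ξ => isClosed_iInter fun η => isClosed_le
    ((continuous_inner_unitBallVN μ ξ η).sub continuous_const).norm continuous_const

lemma isClosed_vanishesOn (V : Set G) : IsClosed {S : UnitBallVN μ | VanishesOn μ S.1 V} := by
  simp only [VanishesOn, ofPred_forall]
  exact isClosed_iInter fun ξ => isClosed_iInter fun η => isClosed_iInter fun _ =>
    isClosed_eq (continuous_inner_unitBallVN μ ξ η) continuous_const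

/-- `C*_r(G)` is norm separable and norm balls are `w*`-closed, so `C*_r(G) ∩ B₁(VN(G))` is an
`F_σδ` set. -/
lemma measurableSet_mem_reducedCStar [MeasurableSpace (UnitBallVN μ)] [BorelSpace (UnitBallVN μ)] :
    MeasurableSet {S : UnitBallVN μ | S.1 ∈ reducedCStar μ} := by
  have : Fact ((1 : ENNReal) ≠ ⊤) := ⟨by simp⟩
  set d := TopologicalSpace.denseSeq (Lp ℂ 1 μ)
  have hcl : reducedCStar μ = closure (range fun n => lambdaL1 μ (d n)) := by
    refine subset_antisymm (closure_minimal ?_ isClosed_closure) (closure_mono ?_)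
    · have := (continuous_lambdaL1 μ).range_subset_closure_image_dense
        (TopologicalSpace.denseRange_denseSeq (Lp ℂ 1 μ))
      rwa [← range_comp] at this
    · rintro _ ⟨n, rfl⟩
      exact mem_range_self _
  have : {S : UnitBallVN μ | S.1 ∈ reducedCStar μ} =
      ⋂ n : ℕ, ⋃ k : ℕ, {S : UnitBallVN μ | ‖S.1 - lambdaL1 μ (d k)‖ ≤ 1 / ((n : ℝ) + 1)} := by
    ext S
    simp only [mem_iInter, mem_iUnion, mem_ofPred_eq, hcl, Metric.mem_closure_range_iff,
      dist_eq_norm]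
    constructor
    · intro h n
      obtain ⟨k, hk⟩ := h _ (Nat.one_div_pos_of_nat (n := n))
      exact ⟨k, hk.le⟩
    · intro h ε hε
      obtain ⟨n, hn⟩ := exists_nat_one_div_lt hε
      obtain ⟨k, hk⟩ := h n
      exact ⟨k, hk.trans_lt hn⟩
  rw [this]
  exact MeasurableSet.iInter fun n => MeasurableSet.iUnion fun k =>
    (isClosed_norm_sub_le μ _ Nat.one_div_pos_of_nat.le).measurableSet

variable [T2Space G]

/-- The inclusion `supp*(T) ⊆ E` in terms of countably many conditions: whenever `E` misses the
compact closure of a basic open set, this closure is covered by finitely many basic open sets on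
which `T` vanishes. -/
lemma opSupport_subset_iff (T : L2 μ →L[ℂ] L2 μ) (E : ClosedSets G) :
    opSupport μ T ⊆ E.1 ↔ ∀ u ∈ precompactBasis G, E.1 ∩ closure u = ∅ →
      ∃ t : Set (Set G), ((t.Finite ∧ t ⊆ precompactBasis G) ∧ closure u ⊆ ⋃₀ t) ∧
        ∀ v ∈ t, VanishesOn μ T v := by
  constructor
  · intro h u hu hE
    obtain ⟨t, ht, htf, hut⟩ := exists_finite_subcover_sUnion hu.2
      (𝒰 := {v | v ∈ precompactBasis G ∧ VanishesOn μ T v})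
      (fun v hv => isOpen_of_mem_precompactBasis hv.1) (fun x hx => by
        have hxT : x ∉ opSupport μ T := fun hxT => hE.subset ⟨h hxT, hx⟩
        obtain ⟨V, hV, hxV, hTV⟩ := (notMem_opSupport_iff μ).1 hxT
        obtain ⟨v, hv, hxv, hvV⟩ := exists_mem_precompactBasis hV hxV
        exact ⟨v, ⟨hv, hTV.mono (subset_closure.trans hvV)⟩, hxv⟩)
    exact ⟨t, ⟨⟨htf, fun v hv => (ht hv).1⟩, hut⟩, fun v hv => (ht hv).2⟩
  · intro h g hg
    by_contra hgE
    obtain ⟨u, hu, hgu, huE⟩ := exists_mem_precompactBasis E.2.isOpen_compl hgE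
    obtain ⟨t, ⟨⟨-, ht⟩, hut⟩, htT⟩ := h u hu
      (eq_empty_of_forall_notMem fun x hx => huE hx.2 hx.1)
    obtain ⟨v, hv, hgv⟩ := hut (subset_closure hgu)
    exact (notMem_opSupport_iff μ).2 ⟨v, isOpen_of_mem_precompactBasis (ht hv), hgv, htT v hv⟩ hg

lemma measurableSet_opSupport_subset [MeasurableSpace (UnitBallVN μ)]
    [BorelSpace (UnitBallVN μ)] :
    MeasurableSet {p : UnitBallVN μ × ClosedSets G | opSupport μ p.1.1 ⊆ p.2.1} := by
  have : {p : UnitBallVN μ × ClosedSets G | opSupport μ p.1.1 ⊆ p.2.1} =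
      ⋂ u ∈ precompactBasis G, (Prod.snd ⁻¹' {E : ClosedSets G | E.1 ∩ closure u = ∅})ᶜ ∪
        ⋃ t ∈ {t : Set (Set G) | (t.Finite ∧ t ⊆ precompactBasis G) ∧ closure u ⊆ ⋃₀ t},
          ⋂ v ∈ t, Prod.fst ⁻¹' {S : UnitBallVN μ | VanishesOn μ S.1 v} := by
    ext p
    simp only [mem_ofPred_eq, opSupport_subset_iff, mem_iInter₂, mem_union, mem_compl_iff,
      mem_preimage, mem_iUnion₂, ← imp_iff_not_or, exists_prop]
  rw [this]
  refine MeasurableSet.biInter countable_precompactBasis fun u hu => ?_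
  refine (measurable_snd (measurableSet_miss hu.2)).compl.union ?_
  refine MeasurableSet.biUnion ((countable_ofPred_finite_subset countable_precompactBasis).mono
    fun t ht => ht.1) fun t ht => ?_
  exact MeasurableSet.biInter ht.1.1.countable fun v _ =>
    measurable_fst (isClosed_vanishesOn μ v).measurableSet

lemma analyticSet_multiplicityPairs : AnalyticSet (multiplicityPairs μ) := by
  borelize (UnitBallVN μ)
  have h0 : MeasurableSet {S : UnitBallVN μ | S.1 ≠ 0} := by
    have h := (isClosed_norm_sub_le μ 0 le_rfl).measurableSet.compl
    simp only [sub_zero, norm_le_zero_iff] at h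
    exact h
  exact ((measurable_fst (measurableSet_mem_reducedCStar μ)).inter
    ((measurable_fst h0).inter (measurableSet_opSupport_subset μ))).analyticSet

omit [T2Space G] in
/-- A witness `S ≠ 0` against uniqueness may be normalized to lie in the unit ball. -/
lemma image_snd_multiplicityPairs :
    Prod.snd '' multiplicityPairs μ = multiplicitySets μ := by
  ext E
  simp only [multiplicitySets, uniquenessSets, mem_compl_iff, mem_ofPred_eq, not_forall]
  constructor
  · rintro ⟨⟨S, F⟩, ⟨hS, hS0, hSE⟩, rfl⟩
    exact ⟨S.1, hS, hSE, hS0⟩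
  · rintro ⟨S, hS, hSE, hS0⟩
    have hn : ((‖S‖ : ℂ))⁻¹ ≠ 0 := inv_ne_zero (by simpa using hS0)
    have hmem := smul_mem_reducedCStar μ (‖S‖ : ℂ)⁻¹ hS
    refine ⟨(⟨(‖S‖ : ℂ)⁻¹ • S, reducedCStar_subset_groupVN μ hmem, ?_⟩, E),
      ⟨hmem, smul_ne_zero hn hS0, ?_⟩, rfl⟩
    · rw [norm_smul, norm_inv, Complex.norm_real, norm_norm,
        inv_mul_cancel₀ (norm_ne_zero_iff.2 hS0)]
    · exact (opSupport_smul μ hn S).trans_subset hSE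

end Pairs

end SetsOfUniqueness

theorem theorem4p7 {G : Type*} [Group G] [TopologicalSpace G] [IsTopologicalGroup G]
    [LocallyCompactSpace G] [T2Space G] [SecondCountableTopology G]
    [MeasurableSpace G] [BorelSpace G] (μ : Measure G) [μ.IsHaarMeasure] :
    (PolishSpace (SetsOfUniqueness.ClosedSets G) ∧ BorelSpace (SetsOfUniqueness.ClosedSets G)) ∧
    SetsOfUniqueness.IsCoanalytic (SetsOfUniqueness.uniquenessSets μ) ∧
    AnalyticSet (SetsOfUniqueness.multiplicityPairs μ) ∧
    Prod.snd '' SetsOfUniqueness.multiplicityPairs μ = SetsOfUniqueness.multiplicitySets μ := by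
  have hA := SetsOfUniqueness.analyticSet_multiplicityPairs μ
  have hI := SetsOfUniqueness.image_snd_multiplicityPairs μ
  refine ⟨⟨inferInstance, inferInstance⟩, ?_, hA, hI⟩
  rw [SetsOfUniqueness.IsCoanalytic, ← SetsOfUniqueness.multiplicitySets, ← hI]
  exact hA.image_of_continuous continuous_snd
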